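/- Let $\mathbb T^3=(\mathbb R/\mathbb Z)^3$. For a smooth divergence-free $u:\mathbb R\times\mathbb T^3\to\mathbb R^3$, $\kappa\ge 0$ and $0\le s<t$, let $\mathcal T^{u,\kappa}_{s,t}$ denote the solution operator $b(s)\mapsto b(t)$ of the induction equation $$\partial_t b-\kappa\Delta b+u\cdot\nabla b-b\cdot\nabla u=0$$ for $b$ on $\mathbb T^3$ with values in $\mathbb C^3$, and for $k,j\in\mathbb Z^3$ let $\hat{\mathcal T}^{u,\kappa}_{s,t}(k,j)\in\mathbb C^{3\times 3}$ be the matrix with $$\hat{\mathcal T}^{u,\kappa}_{s,t}(k,j)\,v=\int_{\mathbb T^3}e^{-2\pi i k\cdot x}\,\mathcal T^{u,\kappa}_{s,t}\big(v\,e^{2\pi i j\cdot(\,\cdot\,)}\big)(x)\,dx\qquad\text{for all }v\in\mathbb C^3 .$$ Write $\mathrm e_x,\mathrm e_y,\mathrm e_z$ for the standard basis vectors. For $\phi\in C_c^\infty((0,1/2))$ with $\phi\ge0$ and $\int\phi=1$ (extended by zero), and $\lambda\in\mathbb R$, put $$U_\lambda(t,x,y,z)=\lambda\phi(t)\cos(2\pi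 x)\,\mathrm e_y+\tfrac14\phi(t-\tfrac12)\sin(2\pi x)\,\mathrm e_z,$$ $$V_\lambda(t,x,y,z)=\lambda\phi(t)\cos(2\pi y)\,\mathrm e_x+\tfrac14\phi(t-\tfrac12)\sin(2\pi y)\,\mathrm e_z,$$ $$W_\lambda(t,x,y,z)=U_\lambda(t,x,y,z)+V_{-\lambda}(t-1,x,y,z).$$ Proposition. There exist $u_1,u_2\in C_c^\infty((0,2)\times\mathbb T^3)$ with $\nabla\cdot u_1=\nabla\cdot u_2=0$, of the form $u_1=W_R$, $u_2=W_{-R}$ for some such $\phi$ and some $R>0$, with the following properties. For each $i\in\{1,2\}$ and every $v\in\mathbb C^3$ the induction equation with velocity $u_i$, $\kappa=0$ and initial datum $v\,e^{2\pi i\mathrm e_z\cdot x}$ at time $0$ has exactly one classical ($C^2$) solution on $[0,2]\times\mathbb T^3$. Let $$A_1=\hat{\mathcal T}^{u_1,0}_{0,2}(\mathrm e_z,\mathrm e_z),\qquad A_2=\hat{\mathcal T}^{u_2,0}_{0,2}(\mathrm e_z,\mathrm e_z).$$ Then $A_1$ and $A_2$ have only simple eigenvalues, and for $i=1,2$ the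 eigenvalues $\lambda_{i,1},\lambda_{i,2},\lambda_{i,3}$ of $A_i$, with eigenvectors $\xi_{i,1},\xi_{i,2},\xi_{i,3}$, can be ordered with $|\lambda_{i,1}|>|\lambda_{i,2}|$ and $|\lambda_{i,1}|>|\lambda_{i,3}|$ in such a way that: 1. $|\lambda_{1,1}|>e$ and $|\lambda_{2,1}|>e$; 2. for all $v\in\mathbb C^3$ with $v\neq0$ and $\mathrm e_z\cdot v=0$, $$v\notin\operatorname{span}\{\xi_{1,2},\xi_{1,3}\}\quad\text{or}\quad v\notin\operatorname{span}\{\xi_{2,2},\xi_{2,3}\}.$$ -/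

import Mathlib

open scoped ContDiff
open MeasureTheory

namespace KinematicDynamo

/-- Points of `ℝ³`. Functions on the torus `𝕋³ = (ℝ/ℤ)³` are the functions on `ℝ³` that are
periodic under translation by `ℤ³`. -/
abbrev R3 := Fin 3 → ℝ

abbrev C3 := Fin 3 → ℂ

/-- A function on `ℝ³` that descends to the torus `(ℝ/ℤ)³`. -/
def TorusPeriodic {E : Type*} (f : R3 → E) : Prop :=
  ∀ (n : Fin 3 → ℤ) (x : R3), f (x + fun i => (n i : ℝ)) = f x

/-- The partial derivative `∂_j f (x)`. -/
noncomputable def pd {E : Type*} [NormedAddCommGroup E] [NormedSpace ℝ E]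
    (j : Fin 3) (f : R3 → E) (x : R3) : E :=
  fderiv ℝ f x (Pi.single j 1)

/-- `u ∈ C_c^∞((t₀, t₁) × 𝕋³; ℝ³)`, extended by zero to all times. -/
structure IsSmoothCompactField (t₀ t₁ : ℝ) (u : ℝ → R3 → R3) : Prop where
  smooth : ContDiff ℝ ∞ (fun p : ℝ × R3 => u p.1 p.2)
  periodic : ∀ t, TorusPeriodic (u t)
  compact_support : ∃ a b : ℝ, t₀ < a ∧ b < t₁ ∧ ∀ t, t ∉ Set.Icc a b → ∀ x, u t x = 0

/-- `∇ · u = 0` at all times. -/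
def DivergenceFree (u : ℝ → R3 → R3) : Prop :=
  ∀ t x, ∑ i, pd i (fun y => u t y i) x = 0

/-- `b` is a classical solution on `[s, t] × 𝕋³` of the induction equation
`∂_t b - κ Δ b + u · ∇ b - b · ∇ u = 0` with `b(s) = b₀`. It is `C²` up to the end times, and so
the initial value is attained continuously. -/
structure IsInductionSolution (u : ℝ → R3 → R3) (κ s t : ℝ) (b₀ : R3 → C3)
    (b : ℝ → R3 → C3) : Prop where
  regular : ContDiffOn ℝ 2 (fun p : ℝ × R3 => b p.1 p.2) (Set.Icc s t ×ˢ Set.univ)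
  periodic : ∀ τ ∈ Set.Icc s t, TorusPeriodic (b τ)
  initial : b s = b₀
  equation : ∀ τ ∈ Set.Ioo s t, ∀ (x : R3) (i : Fin 3),
    deriv (fun r => b r x i) τ
      - (κ : ℂ) * ∑ j, pd j (fun y => pd j (fun w => b τ w i) y) x
      + ∑ j, (u τ x j : ℂ) * pd j (fun y => b τ y i) x
      - ∑ j, b τ x j * ((pd j (fun y => u τ y i) x : ℝ) : ℂ) = 0

/-- The initial value problem from `b₀` at time `s` has exactly one solution on `[s, t]`. -/
def InductionWellPosed (u : ℝ → R3 → R3) (κ s t : ℝ) (b₀ : R3 → C3) : Prop :=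
  ∃ b, IsInductionSolution u κ s t b₀ b ∧
    ∀ b', IsInductionSolution u κ s t b₀ b' → ∀ τ ∈ Set.Icc s t, b' τ = b τ

open Classical in
/-- The solution operator `𝒯^{u,κ}_{s,t}`: it sends `b(s)` to `b(t)`. The value is meaningful
for data with `InductionWellPosed u κ s t b₀`. -/
noncomputable def solutionOperator (u : ℝ → R3 → R3) (κ s t : ℝ) (b₀ : R3 → C3) : R3 → C3 :=
  if h : ∃ b, IsInductionSolution u κ s t b₀ b then h.choose t else 0

/-- The character `x ↦ e^{2πi k·x}`. -/
noncomputable def character (k : Fin 3 → ℤ) (x : R3) : ℂ :=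
  Complex.exp (2 * Real.pi * Complex.I * ∑ i, (k i : ℂ) * (x i : ℂ))

/-- The plane wave `x ↦ v e^{2πi k·x}`. -/
noncomputable def planeWave (k : Fin 3 → ℤ) (v : C3) : R3 → C3 :=
  fun x => character k x • v

/-- The Fourier coefficient `∫_{𝕋³} e^{-2πi k·x} f(x) dx`. -/
noncomputable def fourierCoefficient (k : Fin 3 → ℤ) (f : R3 → C3) : C3 :=
  ∫ x in Set.Icc (0 : R3) 1, character (-k) x • f x

/-- `A` is the Fourier matrix element of `𝒯^{u,κ}_{s,t}` at `(k, j)`: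
`A v = ∫ e^{-2πi k·x} (𝒯^{u,κ}_{s,t} (v e^{2πi j·x})) dx` for every `v ∈ ℂ³`. The
solutions that enter here are required to exist and to be unique. -/
def IsFourierMatrixElement (u : ℝ → R3 → R3) (κ s t : ℝ) (k j : Fin 3 → ℤ)
    (A : Matrix (Fin 3) (Fin 3) ℂ) : Prop :=
  ∀ v : C3, InductionWellPosed u κ s t (planeWave j v) ∧
    A.mulVec v = fourierCoefficient k (solutionOperator u κ s t (planeWave j v))

/-- The basis vector `e_z`. -/
def eZ : Fin 3 → ℤ := ![0, 0, 1]

/-- A time profile: `φ ∈ C_c^∞((0, 1/2))`, nonnegative, with integral one. -/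
structure IsProfile (φ : ℝ → ℝ) : Prop where
  smooth : ContDiff ℝ ∞ φ
  nonneg : ∀ t, 0 ≤ φ t
  compact_support : ∃ a b : ℝ, 0 < a ∧ b < 1 / 2 ∧ ∀ t, t ∉ Set.Icc a b → φ t = 0
  integral_eq_one : ∫ t in (0 : ℝ)..(1 / 2), φ t = 1

/-- `U_l = l φ(t) cos(2πx) e_y + (1/4) φ(t - 1/2) sin(2πx) e_z`. -/
noncomputable def flowU (φ : ℝ → ℝ) (l : ℝ) (t : ℝ) (r : R3) : R3 :=
  ![0, l * φ t * Real.cos (2 * Real.pi * r 0),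
    1 / 4 * φ (t - 1 / 2) * Real.sin (2 * Real.pi * r 0)]

/-- `V_l = l φ(t) cos(2πy) e_x + (1/4) φ(t - 1/2) sin(2πy) e_z`. -/
noncomputable def flowV (φ : ℝ → ℝ) (l : ℝ) (t : ℝ) (r : R3) : R3 :=
  ![l * φ t * Real.cos (2 * Real.pi * r 1), 0,
    1 / 4 * φ (t - 1 / 2) * Real.sin (2 * Real.pi * r 1)]

/-- `W_l(t) = U_l(t) + V_{-l}(t - 1)`. -/
noncomputable def flowW (φ : ℝ → ℝ) (l : ℝ) (t : ℝ) (r : R3) : R3 :=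
  flowU φ l t r + flowV φ (-l) (t - 1) r

/-- All eigenvalues are algebraically simple. -/
def HasSimpleEigenvalues (A : Matrix (Fin 3) (Fin 3) ℂ) : Prop :=
  A.charpoly.roots.Nodup

/-- `ξ 0, ξ 1, ξ 2` are eigenvectors of `A` for three distinct eigenvalues `μ 0, μ 1, μ 2`
(hence for all the eigenvalues of `A`), listed with an eigenvalue of strictly largest modulus
first. -/
structure IsEigenSystem (A : Matrix (Fin 3) (Fin 3) ℂ) (μ : Fin 3 → ℂ) (ξ : Fin 3 → C3) :
    Prop where
  distinct : Function.Injective μ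
  ne_zero : ∀ a, ξ a ≠ 0
  eigen : ∀ a, A.mulVec (ξ a) = μ a • ξ a
  top : ∀ a, a ≠ 0 → ‖μ a‖ < ‖μ 0‖

end KinematicDynamo

open KinematicDynamo

namespace KinematicDynamo

/-! Without diffusion, Cauchy's formula gives the solution: the datum is transported by the flow and
multiplied by its differential. The velocity acts in four disjoint pulses, so the flow is an
explicit composition of two shears, with inverse `shearInv` and differential `stretch`.
`IsInductionSolution.eq_stretchAt` proves the formula for every solution, hence uniqueness;
`isInductionSolution_stretchAt` gives existence.

For the datum `v e^{2πiz}` at time `2`, the integrand of the Fourier coefficient is a sum of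
products of a function of `y` and a function of `x + l cos 2πy`. Periodicity absorbs the shift, so
each integral over the cube splits into two circle integrals (`integral_cube_mul_shift`). These are
`J₀(π/2)`, `-i J₁(π/2)` and `0`, for the weights `1`, `sin` and `cos`. The vanishing cosine integral
decouples `e_z`, and the matrix is `dynamoMatrix α` with `α = 2πl J₁(π/2)`. Its entry `α²`, from the
product of both stretchings, produces growth.

The eigenvalues are `J₀² + ν`, `J₀² + α² - ν` and `J₀²`, where `ν > α²` is the larger root of `ν² =
α²ν + α²J₀²`; a large `|α|` thus makes the first exceed `e`. The subdominant eigenvectors are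
`(iαJ₀, ν, 0)` and `e_z`. Changing the sign of `α` preserves `ν` and flips only the first
coordinate, so the two subdominant planes share only the line of `e_z`. -/

/-! ### Shear maps and their differentials. -/

/-- Composition of the shear `(x, y + a cos 2πx, z + c sin 2πx)` with the shear
`(x + a' cos 2πy, y, z + c' sin 2πy)`. -/
noncomputable def shearMap (a c a' c' : ℝ) (X : R3) : R3 :=
  ![X 0 + a' * Real.cos (2 * Real.pi * (X 1 + a * Real.cos (2 * Real.pi * X 0))),
    X 1 + a * Real.cos (2 * Real.pi * X 0),
    X 2 + c * Real.sin (2 * Real.pi * X 0)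
      + c' * Real.sin (2 * Real.pi * (X 1 + a * Real.cos (2 * Real.pi * X 0)))]

/-- The inverse of `shearMap`. -/
noncomputable def shearInv (a c a' c' : ℝ) (x : R3) : R3 :=
  ![x 0 - a' * Real.cos (2 * Real.pi * x 1),
    x 1 - a * Real.cos (2 * Real.pi * (x 0 - a' * Real.cos (2 * Real.pi * x 1))),
    x 2 - c' * Real.sin (2 * Real.pi * x 1)
      - c * Real.sin (2 * Real.pi * (x 0 - a' * Real.cos (2 * Real.pi * x 1)))]

/-- The differential of `shearMap` at the preimage of `x`, applied to `w`. -/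
noncomputable def stretch (a c a' c' : ℝ) (x : R3) (w : C3) : C3 :=
  let s : ℝ := -(2 * Real.pi * a * Real.sin (2 * Real.pi * shearInv a c a' c' x 0))
  let d : ℝ := 2 * Real.pi * c * Real.cos (2 * Real.pi * shearInv a c a' c' x 0)
  let s' : ℝ := -(2 * Real.pi * a' * Real.sin (2 * Real.pi * x 1))
  let d' : ℝ := 2 * Real.pi * c' * Real.cos (2 * Real.pi * x 1)
  ![w 0 + s' * (w 1 + s * w 0), w 1 + s * w 0, w 2 + d * w 0 + d' * (w 1 + s * w 0)]

/-- The inverse of `stretch`. -/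
noncomputable def unstretch (a c a' c' : ℝ) (x : R3) (w : C3) : C3 :=
  let s : ℝ := -(2 * Real.pi * a * Real.sin (2 * Real.pi * shearInv a c a' c' x 0))
  let d : ℝ := 2 * Real.pi * c * Real.cos (2 * Real.pi * shearInv a c a' c' x 0)
  let s' : ℝ := -(2 * Real.pi * a' * Real.sin (2 * Real.pi * x 1))
  let d' : ℝ := 2 * Real.pi * c' * Real.cos (2 * Real.pi * x 1)
  ![w 0 - s' * w 1, w 1 - s * (w 0 - s' * w 1), w 2 - d' * w 1 - d * (w 0 - s' * w 1)]

lemma shearMap_shearInv (a c a' c' : ℝ) (x : R3) :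
    shearMap a c a' c' (shearInv a c a' c' x) = x := by
  ext i
  fin_cases i <;> simp [shearMap, shearInv]

lemma shearInv_shearMap (a c a' c' : ℝ) (x : R3) :
    shearInv a c a' c' (shearMap a c a' c' x) = x := by
  ext i
  fin_cases i <;> simp [shearMap, shearInv]

lemma stretch_unstretch (a c a' c' : ℝ) (x : R3) (w : C3) :
    stretch a c a' c' x (unstretch a c a' c' x w) = w := by
  ext i
  fin_cases i <;> simp [stretch, unstretch]

lemma shearMap_zero (x : R3) : shearMap 0 0 0 0 x = x := by
  ext i
  fin_cases i <;> simp [shearMap]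

lemma shearInv_zero (x : R3) : shearInv 0 0 0 0 x = x := by
  ext i
  fin_cases i <;> simp [shearInv]

lemma stretch_zero (x : R3) (w : C3) : stretch 0 0 0 0 x w = w := by
  ext i
  fin_cases i <;> simp [stretch]

lemma unstretch_zero (x : R3) (w : C3) : unstretch 0 0 0 0 x w = w := by
  ext i
  fin_cases i <;> simp [unstretch]

/-! ### Time profiles. -/

/-- The primitive of a profile. -/
noncomputable def primitive (φ : ℝ → ℝ) (t : ℝ) : ℝ := ∫ s in (0 : ℝ)..t, φ s

namespace IsProfile

variable {φ : ℝ → ℝ}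

lemma eq_zero_of_nonpos (h : IsProfile φ) {t : ℝ} (ht : t ≤ 0) : φ t = 0 := by
  obtain ⟨a, b, ha, -, h0⟩ := h.compact_support
  exact h0 t fun hm => by linarith [hm.1]

lemma eq_zero_of_half_le (h : IsProfile φ) {t : ℝ} (ht : 1 / 2 ≤ t) : φ t = 0 := by
  obtain ⟨a, b, -, hb, h0⟩ := h.compact_support
  exact h0 t fun hm => by linarith [hm.2]

lemma hasDerivAt_primitive (h : IsProfile φ) (t : ℝ) : HasDerivAt (primitive φ) (φ t) t :=
  intervalIntegral.integral_hasDerivAt_right (h.smooth.continuous.intervalIntegrable _ _)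
    (h.smooth.continuous.stronglyMeasurableAtFilter _ _) h.smooth.continuous.continuousAt

lemma contDiff_primitive (h : IsProfile φ) : ContDiff ℝ ∞ (primitive φ) := by
  rw [contDiff_infty_iff_deriv]
  refine ⟨fun t => (h.hasDerivAt_primitive t).differentiableAt, ?_⟩
  rw [show deriv (primitive φ) = φ from funext fun t => (h.hasDerivAt_primitive t).deriv]
  exact h.smooth

lemma primitive_of_nonpos (h : IsProfile φ) {t : ℝ} (ht : t ≤ 0) : primitive φ t = 0 := by
  unfold primitive
  rw [intervalIntegral.integral_congr (g := fun _ => 0)]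
  · simp
  · intro s hs
    rw [Set.uIcc_of_ge ht] at hs
    exact h.eq_zero_of_nonpos hs.2

lemma primitive_of_half_le (h : IsProfile φ) {t : ℝ} (ht : 1 / 2 ≤ t) : primitive φ t = 1 := by
  unfold primitive
  rw [← intervalIntegral.integral_add_adjacent_intervals
    (h.smooth.continuous.intervalIntegrable 0 (1 / 2))
    (h.smooth.continuous.intervalIntegrable (1 / 2) t), h.integral_eq_one,
    intervalIntegral.integral_congr (g := fun _ => 0)]
  · simp
  · intro s hs
    rw [Set.uIcc_of_le ht] at hs
    exact h.eq_zero_of_half_le hs.1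

end IsProfile

lemma exists_isProfile : ∃ φ, IsProfile φ := by
  let f : ContDiffBump (1 / 4 : ℝ) := ⟨1 / 16, 1 / 8, by norm_num, by norm_num⟩
  have h0 : ∀ t, t ∉ Set.Icc (1 / 8 : ℝ) (3 / 8) → f.normed volume t = 0 := by
    intro t ht
    rw [← Function.notMem_support, f.support_normed_eq, Real.ball_eq_Ioo]
    intro hm
    simp only [f, Set.mem_Ioo] at hm
    exact ht ⟨by linarith [hm.1], by linarith [hm.2]⟩
  refine ⟨f.normed volume, f.contDiff_normed, fun t => f.nonneg_normed t,
    ⟨1 / 8, 3 / 8, by norm_num, by norm_num, h0⟩, ?_⟩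
  rw [intervalIntegral.integral_eq_integral_of_support_subset, f.integral_normed]
  intro t ht
  by_contra hm
  refine ht (h0 t fun h1 => hm ⟨by linarith [h1.1], by linarith [h1.2]⟩)

/-! ### The velocity field. -/

lemma flowW_apply_zero (φ : ℝ → ℝ) (l t : ℝ) (r : R3) :
    flowW φ l t r 0 = -l * φ (t - 1) * Real.cos (2 * Real.pi * r 1) := by
  simp [flowW, flowU, flowV]

lemma flowW_apply_one (φ : ℝ → ℝ) (l t : ℝ) (r : R3) :
    flowW φ l t r 1 = l * φ t * Real.cos (2 * Real.pi * r 0) := by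
  simp [flowW, flowU, flowV]

lemma flowW_apply_two (φ : ℝ → ℝ) (l t : ℝ) (r : R3) :
    flowW φ l t r 2 = 1 / 4 * φ (t - 1 / 2) * Real.sin (2 * Real.pi * r 0)
      + 1 / 4 * φ (t - 1 - 1 / 2) * Real.sin (2 * Real.pi * r 1) := by
  simp [flowW, flowU, flowV]

lemma hasDerivAt_cos_two_pi (x : ℝ) : HasDerivAt (fun s => Real.cos (2 * Real.pi * s))
    (-(2 * Real.pi * Real.sin (2 * Real.pi * x))) x := by
  have := (Real.hasDerivAt_cos (2 * Real.pi * x)).comp x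
    ((hasDerivAt_id x).const_mul (2 * Real.pi))
  exact this.congr_deriv (by ring)

lemma hasDerivAt_sin_two_pi (x : ℝ) : HasDerivAt (fun s => Real.sin (2 * Real.pi * s))
    (2 * Real.pi * Real.cos (2 * Real.pi * x)) x := by
  have := (Real.hasDerivAt_sin (2 * Real.pi * x)).comp x
    ((hasDerivAt_id x).const_mul (2 * Real.pi))
  exact this.congr_deriv (by ring)

lemma hasFDerivAt_comp_coord {g : ℝ → ℝ} {g' : ℝ} {k : Fin 3} {x : R3}
    (hg : HasDerivAt g g' (x k)) : HasFDerivAt (fun y : R3 => g (y k))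
      (g' • (ContinuousLinearMap.proj k : R3 →L[ℝ] ℝ)) x :=
  hg.comp_hasFDerivAt x (ContinuousLinearMap.proj k : R3 →L[ℝ] ℝ).hasFDerivAt

lemma pd_flowW_zero (φ : ℝ → ℝ) (l t : ℝ) (x : R3) (j : Fin 3) :
    pd j (fun y => flowW φ l t y 0) x = if j = 1 then
      2 * Real.pi * l * φ (t - 1) * Real.sin (2 * Real.pi * x 1) else 0 := by
  simp only [flowW_apply_zero, pd]
  rw [(hasFDerivAt_comp_coord (k := 1)
    ((hasDerivAt_cos_two_pi (x 1)).const_mul (-l * φ (t - 1)))).fderiv]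
  fin_cases j <;> simp
  ring

lemma pd_flowW_one (φ : ℝ → ℝ) (l t : ℝ) (x : R3) (j : Fin 3) :
    pd j (fun y => flowW φ l t y 1) x = if j = 0 then
      -(2 * Real.pi * l * φ t * Real.sin (2 * Real.pi * x 0)) else 0 := by
  simp only [flowW_apply_one, pd]
  rw [(hasFDerivAt_comp_coord (k := 0)
    ((hasDerivAt_cos_two_pi (x 0)).const_mul (l * φ t))).fderiv]
  fin_cases j <;> simp
  ring

lemma pd_flowW_two (φ : ℝ → ℝ) (l t : ℝ) (x : R3) (j : Fin 3) :
    pd j (fun y => flowW φ l t y 2) x = if j = 0 then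
      2 * Real.pi * (1 / 4 * φ (t - 1 / 2)) * Real.cos (2 * Real.pi * x 0) else if j = 1 then
      2 * Real.pi * (1 / 4 * φ (t - 1 - 1 / 2)) * Real.cos (2 * Real.pi * x 1) else 0 := by
  simp only [flowW_apply_two, pd]
  rw [((hasFDerivAt_comp_coord (k := 0)
    ((hasDerivAt_sin_two_pi (x 0)).const_mul (1 / 4 * φ (t - 1 / 2)))).fun_add
    (hasFDerivAt_comp_coord (k := 1)
    ((hasDerivAt_sin_two_pi (x 1)).const_mul (1 / 4 * φ (t - 1 - 1 / 2))))).fderiv]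
  fin_cases j <;> simp <;> ring

lemma divergenceFree_flowW (φ : ℝ → ℝ) (l : ℝ) : DivergenceFree (flowW φ l) := by
  intro t x
  rw [Fin.sum_univ_three, pd_flowW_zero, pd_flowW_one, pd_flowW_two]
  simp

lemma cos_two_pi_add_int (x : ℝ) (n : ℤ) :
    Real.cos (2 * Real.pi * (x + n)) = Real.cos (2 * Real.pi * x) := by
  rw [mul_add, mul_comm (2 * Real.pi) (n : ℝ), Real.cos_add_int_mul_two_pi]

lemma sin_two_pi_add_int (x : ℝ) (n : ℤ) :
    Real.sin (2 * Real.pi * (x + n)) = Real.sin (2 * Real.pi * x) := by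
  rw [mul_add, mul_comm (2 * Real.pi) (n : ℝ), Real.sin_add_int_mul_two_pi]

lemma isSmoothCompactField_flowW {φ : ℝ → ℝ} (h : IsProfile φ) (l : ℝ) :
    IsSmoothCompactField 0 2 (flowW φ l) where
  smooth := by
    have hφ := h.smooth
    rw [contDiff_pi]
    intro i
    fin_cases i
    · simp only [Fin.zero_eta, flowW_apply_zero]; fun_prop
    · simp only [Fin.mk_one, flowW_apply_one]; fun_prop
    · simp only [Fin.reduceFinMk, flowW_apply_two]; fun_prop
  periodic := by
    intro t n x
    ext i
    fin_cases i
    · simp only [Fin.zero_eta, flowW_apply_zero, Pi.add_apply, cos_two_pi_add_int]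
    · simp only [Fin.mk_one, flowW_apply_one, Pi.add_apply, cos_two_pi_add_int]
    · simp only [Fin.reduceFinMk, flowW_apply_two, Pi.add_apply, sin_two_pi_add_int]
  compact_support := by
    obtain ⟨a, b, ha, hb, h0⟩ := h.compact_support
    -- The last of the four pulses is delayed by `3/2`, and `b < 1/2` keeps its end below `2`.
    refine ⟨a, b + 3 / 2, ha, by linarith, fun t ht x => ?_⟩
    have hs : ∀ s, 0 ≤ s → s ≤ 3 / 2 → φ (t - s) = 0 := fun s h1 h2 =>
      h0 _ fun hm => ht ⟨by linarith [hm.1], by linarith [hm.2]⟩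
    have e0 : φ t = 0 := by simpa using hs 0 le_rfl (by norm_num)
    have e3 : φ (t - 1 - 1 / 2) = 0 := by
      rw [sub_sub]; exact hs _ (by norm_num) (by norm_num)
    ext i
    fin_cases i
    · simp [flowW_apply_zero, hs 1 (by norm_num) (by norm_num)]
    · simp [flowW_apply_one, e0]
    · simp only [Fin.reduceFinMk, flowW_apply_two, hs (1 / 2) (by norm_num) (by norm_num), e3]
      simp

/-! ### The flow and its differential along trajectories. -/

/-- The flow map from time `0` to time `t` of `flowW φ l`, for `0 ≤ t ≤ 2`. -/
noncomputable def flowAt (φ : ℝ → ℝ) (l t : ℝ) : R3 → R3 :=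
  shearMap (l * primitive φ t) (1 / 4 * primitive φ (t - 1 / 2))
    (-l * primitive φ (t - 1)) (1 / 4 * primitive φ (t - 1 - 1 / 2))

noncomputable def invAt (φ : ℝ → ℝ) (l t : ℝ) : R3 → R3 :=
  shearInv (l * primitive φ t) (1 / 4 * primitive φ (t - 1 / 2))
    (-l * primitive φ (t - 1)) (1 / 4 * primitive φ (t - 1 - 1 / 2))

noncomputable def stretchAt (φ : ℝ → ℝ) (l t : ℝ) : R3 → C3 → C3 :=
  stretch (l * primitive φ t) (1 / 4 * primitive φ (t - 1 / 2))
    (-l * primitive φ (t - 1)) (1 / 4 * primitive φ (t - 1 - 1 / 2))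

noncomputable def unstretchAt (φ : ℝ → ℝ) (l t : ℝ) : R3 → C3 → C3 :=
  unstretch (l * primitive φ t) (1 / 4 * primitive φ (t - 1 / 2))
    (-l * primitive φ (t - 1)) (1 / 4 * primitive φ (t - 1 - 1 / 2))

/-- The chain rule along a curve, in terms of partial derivatives. -/
lemma hasDerivAt_along {B : ℝ → R3 → ℂ} {τ : ℝ} {γ : ℝ → R3} {w : R3}
    (hB : DifferentiableAt ℝ (fun p : ℝ × R3 => B p.1 p.2) (τ, γ τ)) (hγ : HasDerivAt γ w τ) :
    HasDerivAt (fun s => B s (γ s))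
      (deriv (fun r => B r (γ τ)) τ + ∑ j, (w j : ℂ) * pd j (fun y => B τ y) (γ τ)) τ := by
  set F := fderiv ℝ (fun p : ℝ × R3 => B p.1 p.2) (τ, γ τ) with hF
  have h1 : deriv (fun r => B r (γ τ)) τ = F (1, 0) :=
    (HasFDerivAt.comp_hasDerivAt (l := fun p : ℝ × R3 => B p.1 p.2) τ hB.hasFDerivAt
      ((hasDerivAt_id τ).prodMk (hasDerivAt_const τ (γ τ)))).deriv
  have h2 : ∀ j, pd j (fun y => B τ y) (γ τ) = F (0, Pi.single j 1) := by
    intro j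
    have h3 : HasFDerivAt (fun y => B τ y) (F.comp (ContinuousLinearMap.inr ℝ ℝ R3)) (γ τ) :=
      hB.hasFDerivAt.comp (γ τ) (hasFDerivAt_prodMk_right τ (γ τ))
    rw [pd, h3.fderiv]
    simp
  have h4 : HasDerivAt (fun s => B s (γ s)) (F (1, w)) τ :=
    HasFDerivAt.comp_hasDerivAt (l := fun p : ℝ × R3 => B p.1 p.2) τ hB.hasFDerivAt
      ((hasDerivAt_id τ).prodMk hγ)
  refine h4.congr_deriv ?_
  have h5 : ((1 : ℝ), w) = (1, 0) + ∑ j, w j • ((0 : ℝ), (Pi.single j 1 : R3)) := by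
    ext i
    · simp [Prod.fst_sum]
    · fin_cases i <;> simp [Fin.sum_univ_three]
  rw [h5, map_add, map_sum, h1]
  simp only [map_smul, h2, Complex.real_smul]

/-- The induction equation is imposed only at interior times; continuity carries the conserved
quantity to the end times. -/
lemma eq_left_of_hasDerivAt_zero {f : ℝ → ℂ} {a b : ℝ} (hab : a ≤ b)
    (hc : ContinuousOn f (Set.Icc a b)) (hd : ∀ t ∈ Set.Ioo a b, HasDerivAt f 0 t) :
    f b = f a := by
  have := intervalIntegral.integral_eq_sub_of_hasDerivAt_of_le hab hc hd
    (by simp)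
  simpa [eq_comm, sub_eq_zero] using this

variable {φ : ℝ → ℝ}

lemma flowAt_zero (h : IsProfile φ) (l : ℝ) (x : R3) : flowAt φ l 0 x = x := by
  rw [flowAt, h.primitive_of_nonpos le_rfl, h.primitive_of_nonpos (by norm_num),
    h.primitive_of_nonpos (by norm_num), h.primitive_of_nonpos (by norm_num)]
  simp [shearMap_zero]

lemma invAt_zero (h : IsProfile φ) (l : ℝ) (x : R3) : invAt φ l 0 x = x := by
  rw [invAt, h.primitive_of_nonpos le_rfl, h.primitive_of_nonpos (by norm_num),
    h.primitive_of_nonpos (by norm_num), h.primitive_of_nonpos (by norm_num)]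
  simp [shearInv_zero]

lemma stretchAt_zero (h : IsProfile φ) (l : ℝ) (x : R3) (w : C3) : stretchAt φ l 0 x w = w := by
  rw [stretchAt, h.primitive_of_nonpos le_rfl, h.primitive_of_nonpos (by norm_num),
    h.primitive_of_nonpos (by norm_num), h.primitive_of_nonpos (by norm_num)]
  simp [stretch_zero]

lemma unstretchAt_zero (h : IsProfile φ) (l : ℝ) (x : R3) (w : C3) :
    unstretchAt φ l 0 x w = w := by
  rw [unstretchAt, h.primitive_of_nonpos le_rfl, h.primitive_of_nonpos (by norm_num),
    h.primitive_of_nonpos (by norm_num), h.primitive_of_nonpos (by norm_num)]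
  simp [unstretch_zero]

/-- At each time one of the two shears is at rest, and the second one is trivial up to time
`1`. -/
lemma IsProfile.separation (h : IsProfile φ) (t : ℝ) :
    (primitive φ (t - 1) = 0 ∧ primitive φ (t - 1 - 1 / 2) = 0 ∧ φ (t - 1) = 0 ∧
      φ (t - 1 - 1 / 2) = 0) ∨ (φ t = 0 ∧ φ (t - 1 / 2) = 0) := by
  rcases le_total t 1 with ht | ht
  · exact .inl ⟨h.primitive_of_nonpos (by linarith), h.primitive_of_nonpos (by linarith),
      h.eq_zero_of_nonpos (by linarith), h.eq_zero_of_nonpos (by linarith)⟩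
  · exact .inr ⟨h.eq_zero_of_half_le (by linarith), h.eq_zero_of_half_le (by linarith)⟩

lemma hasDerivAt_primitive_sub (h : IsProfile φ) (c t : ℝ) :
    HasDerivAt (fun s => primitive φ (s - c)) (φ (t - c)) t :=
  (h.hasDerivAt_primitive (t - c)).comp_sub_const t c

lemma hasDerivAt_primitive_sub_sub (h : IsProfile φ) (c d t : ℝ) :
    HasDerivAt (fun s => primitive φ (s - c - d)) (φ (t - c - d)) t :=
  (hasDerivAt_primitive_sub h d (t - c)).comp_sub_const t c

lemma hasDerivAt_flowAt_one (h : IsProfile φ) (l : ℝ) (X : R3) (t : ℝ) :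
    HasDerivAt (fun s => flowAt φ l s X 1) (l * φ t * Real.cos (2 * Real.pi * X 0)) t := by
  simp only [flowAt, shearMap, Matrix.cons_val]
  exact (((h.hasDerivAt_primitive t).const_mul l).mul_const _).const_add _

lemma flowAt_apply_zero_of_rest (l : ℝ) (X : R3) (t : ℝ) (e : primitive φ (t - 1) = 0) :
    flowAt φ l t X 0 = X 0 := by
  simp [flowAt, shearMap, e]

/-- Up to time `1` the `x`-coordinate is still its initial value, so the first shear sees the
correct argument. Afterwards `y` is frozen, so the product rule gives no extra terms in the second
shear. -/
lemma hasDerivAt_flowAt (h : IsProfile φ) (l : ℝ) (X : R3) (t : ℝ) :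
    HasDerivAt (fun s => flowAt φ l s X) (flowW φ l t (flowAt φ l t X)) t := by
  have h1 := hasDerivAt_flowAt_one h l X t
  have hc := (hasDerivAt_cos_two_pi _).comp t h1
  have hs := (hasDerivAt_sin_two_pi _).comp t h1
  have h0 := ((((hasDerivAt_primitive_sub h 1 t).const_mul (-l)).mul hc).const_add (X 0))
  have h2 := ((((hasDerivAt_primitive_sub h (1 / 2) t).const_mul (1 / 4)).mul_const
    (Real.sin (2 * Real.pi * X 0))).const_add (X 2)).add
    (((hasDerivAt_primitive_sub_sub h 1 (1 / 2) t).const_mul (1 / 4)).mul hs)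
  rw [hasDerivAt_pi]
  intro i
  fin_cases i
  · refine h0.congr_deriv ?_
    rw [Fin.zero_eta, flowW_apply_zero]
    rcases h.separation t with ⟨e1, e2, e3, e4⟩ | ⟨e1, e2⟩
    · simp only [e1, e3, Function.comp_apply]
      ring
    · simp only [e1, Function.comp_apply]
      ring
  · refine h1.congr_deriv ?_
    rw [Fin.mk_one, flowW_apply_one]
    rcases h.separation t with ⟨e1, -⟩ | ⟨e1, -⟩
    · rw [flowAt_apply_zero_of_rest l X t e1]
    · simp [e1]
  · refine h2.congr_deriv ?_
    rw [show (⟨2, by simp⟩ : Fin 3) = 2 from rfl, flowW_apply_two]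
    rcases h.separation t with ⟨e1, e2, e3, e4⟩ | ⟨e1, e2⟩
    · rw [flowAt_apply_zero_of_rest l X t e1]
      simp only [e2, e4, Function.comp_apply]
      ring
    · simp only [e1, e2, Function.comp_apply]
      ring

/-- The right-hand side `w · ∇u` of the equation along trajectories. -/
noncomputable def velocityGradient (u : R3 → R3) (x : R3) (w : C3) (i : Fin 3) : ℂ :=
  ∑ j, w j * ((pd j (fun y => u y i) x : ℝ) : ℂ)

lemma velocityGradient_zero (l t : ℝ) (x : R3) (w : C3) :
    velocityGradient (flowW φ l t) x w 0 =
      w 1 * ((2 * Real.pi * l * φ (t - 1) * Real.sin (2 * Real.pi * x 1) : ℝ) : ℂ) := by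
  simp [velocityGradient, Fin.sum_univ_three, pd_flowW_zero]

lemma velocityGradient_one (l t : ℝ) (x : R3) (w : C3) :
    velocityGradient (flowW φ l t) x w 1 =
      w 0 * ((-(2 * Real.pi * l * φ t * Real.sin (2 * Real.pi * x 0)) : ℝ) : ℂ) := by
  simp [velocityGradient, Fin.sum_univ_three, pd_flowW_one]

lemma velocityGradient_two (l t : ℝ) (x : R3) (w : C3) :
    velocityGradient (flowW φ l t) x w 2 =
      w 0 * ((2 * Real.pi * (1 / 4 * φ (t - 1 / 2)) * Real.cos (2 * Real.pi * x 0) : ℝ) : ℂ) +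
      w 1 * ((2 * Real.pi * (1 / 4 * φ (t - 1 - 1 / 2)) *
        Real.cos (2 * Real.pi * x 1) : ℝ) : ℂ) := by
  simp [velocityGradient, Fin.sum_univ_three, pd_flowW_two]

/-- The entries of `stretchAt` along a trajectory. -/
lemma stretchAt_flowAt (l t : ℝ) (X : R3) (w : C3) :
    stretchAt φ l t (flowAt φ l t X) w =
      let s : ℝ := -(2 * Real.pi * (l * primitive φ t) * Real.sin (2 * Real.pi * X 0))
      let d : ℝ := 2 * Real.pi * (1 / 4 * primitive φ (t - 1 / 2)) * Real.cos (2 * Real.pi * X 0)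
      let s' : ℝ := -(2 * Real.pi * (-l * primitive φ (t - 1)) *
        Real.sin (2 * Real.pi * flowAt φ l t X 1))
      let d' : ℝ := 2 * Real.pi * (1 / 4 * primitive φ (t - 1 - 1 / 2)) *
        Real.cos (2 * Real.pi * flowAt φ l t X 1)
      ![w 0 + s' * (w 1 + s * w 0), w 1 + s * w 0,
        w 2 + d * w 0 + d' * (w 1 + s * w 0)] := by
  simp only [stretchAt, flowAt, stretch, shearInv_shearMap]

lemma unstretchAt_flowAt (l t : ℝ) (X : R3) (w : C3) :
    unstretchAt φ l t (flowAt φ l t X) w =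
      let s : ℝ := -(2 * Real.pi * (l * primitive φ t) * Real.sin (2 * Real.pi * X 0))
      let d : ℝ := 2 * Real.pi * (1 / 4 * primitive φ (t - 1 / 2)) * Real.cos (2 * Real.pi * X 0)
      let s' : ℝ := -(2 * Real.pi * (-l * primitive φ (t - 1)) *
        Real.sin (2 * Real.pi * flowAt φ l t X 1))
      let d' : ℝ := 2 * Real.pi * (1 / 4 * primitive φ (t - 1 - 1 / 2)) *
        Real.cos (2 * Real.pi * flowAt φ l t X 1)
      ![w 0 - s' * w 1, w 1 - s * (w 0 - s' * w 1),
        w 2 - d' * w 1 - d * (w 0 - s' * w 1)] := by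
  simp only [unstretchAt, flowAt, unstretch, shearInv_shearMap]

section Derivatives

variable (h : IsProfile φ) (l : ℝ) (X : R3) (t : ℝ)
include h

lemma hasDerivAt_first_sin : HasDerivAt
    (fun s => ((-(2 * Real.pi * (l * primitive φ s) * Real.sin (2 * Real.pi * X 0)) : ℝ) : ℂ))
    ((-(2 * Real.pi * (l * φ t) * Real.sin (2 * Real.pi * X 0)) : ℝ) : ℂ) t :=
  (((((h.hasDerivAt_primitive t).const_mul l).const_mul (2 * Real.pi)).mul_const _).neg).ofReal_comp

lemma hasDerivAt_first_cos : HasDerivAt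
    (fun s => ((2 * Real.pi * (1 / 4 * primitive φ (s - 1 / 2)) *
      Real.cos (2 * Real.pi * X 0) : ℝ) : ℂ))
    ((2 * Real.pi * (1 / 4 * φ (t - 1 / 2)) * Real.cos (2 * Real.pi * X 0) : ℝ) : ℂ) t :=
  ((((hasDerivAt_primitive_sub h (1 / 2) t).const_mul (1 / 4)).const_mul
    (2 * Real.pi)).mul_const _).ofReal_comp

/-- Differentiating the moving coordinate `y` would add a term containing `φ t * primitive φ (t -
1)`; one of these factors always vanishes. -/
lemma hasDerivAt_second_sin : HasDerivAt
    (fun s => ((-(2 * Real.pi * (-l * primitive φ (s - 1)) *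
      Real.sin (2 * Real.pi * flowAt φ l s X 1)) : ℝ) : ℂ))
    ((-(2 * Real.pi * (-l * φ (t - 1)) * Real.sin (2 * Real.pi * flowAt φ l t X 1)) : ℝ) : ℂ)
    t := by
  have hs := (hasDerivAt_sin_two_pi _).comp t (hasDerivAt_flowAt_one h l X t)
  refine (((((hasDerivAt_primitive_sub h 1 t).const_mul (-l)).const_mul
    (2 * Real.pi)).mul hs).neg.congr_deriv ?_).ofReal_comp
  rcases h.separation t with ⟨e1, e2, e3, e4⟩ | ⟨e1, e2⟩
  · simp only [e1, e3, Function.comp_apply]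
    ring
  · simp only [e1, Function.comp_apply]
    ring

lemma hasDerivAt_second_cos : HasDerivAt
    (fun s => ((2 * Real.pi * (1 / 4 * primitive φ (s - 1 - 1 / 2)) *
      Real.cos (2 * Real.pi * flowAt φ l s X 1) : ℝ) : ℂ))
    ((2 * Real.pi * (1 / 4 * φ (t - 1 - 1 / 2)) *
      Real.cos (2 * Real.pi * flowAt φ l t X 1) : ℝ) : ℂ) t := by
  have hc := (hasDerivAt_cos_two_pi _).comp t (hasDerivAt_flowAt_one h l X t)
  refine (((((hasDerivAt_primitive_sub_sub h 1 (1 / 2) t).const_mul (1 / 4)).const_mul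
    (2 * Real.pi)).mul hc).congr_deriv ?_).ofReal_comp
  rcases h.separation t with ⟨e1, e2, e3, e4⟩ | ⟨e1, e2⟩
  · simp only [e2, e4, Function.comp_apply]
    ring
  · simp only [e1, Function.comp_apply]
    ring

/-- `stretchAt` solves the equation along trajectories. -/
lemma hasDerivAt_stretchAt (w : C3) (i : Fin 3) :
    HasDerivAt (fun s => stretchAt φ l s (flowAt φ l s X) w i)
      (velocityGradient (flowW φ l t) (flowAt φ l t X)
        (stretchAt φ l t (flowAt φ l t X) w) i) t := by
  have k1 := hasDerivAt_first_sin h l X t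
  have k2 := hasDerivAt_first_cos h X t
  have k3 := hasDerivAt_second_sin h l X t
  have k4 := hasDerivAt_second_cos h l X t
  have m1 := (k1.mul_const (w 0)).const_add (w 1)
  simp only [stretchAt_flowAt]
  fin_cases i
  · rw [Fin.zero_eta, velocityGradient_zero]
    refine ((k3.mul m1).const_add (w 0)).congr_deriv ?_
    rcases h.separation t with ⟨e1, e2, e3, e4⟩ | ⟨e1, e2⟩
    · simp only [e1, e2, e3]
      push_cast
      ring
    · simp only [e1]
      push_cast
      ring
  · rw [Fin.mk_one, velocityGradient_one]
    refine m1.congr_deriv ?_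
    rcases h.separation t with ⟨e1, e2, e3, e4⟩ | ⟨e1, e2⟩
    · rw [flowAt_apply_zero_of_rest l X t e1]
      simp only [e1, e2]
      push_cast
      ring
    · simp only [e1]
      push_cast
      ring
  · rw [show (⟨2, by simp⟩ : Fin 3) = 2 from rfl, velocityGradient_two]
    refine (((k2.mul_const (w 0)).const_add (w 2)).add (k4.mul m1)).congr_deriv ?_
    rcases h.separation t with ⟨e1, e2, e3, e4⟩ | ⟨e1, e2⟩
    · rw [flowAt_apply_zero_of_rest l X t e1]
      simp only [e1, e2, e4]
      push_cast
      ring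
    · simp only [e1, e2]
      push_cast
      ring

/-- Undoing `stretchAt` makes a solution constant along trajectories. -/
lemma hasDerivAt_unstretchAt {β : ℝ → C3}
    (hβ : ∀ i, HasDerivAt (fun s => β s i)
      (velocityGradient (flowW φ l t) (flowAt φ l t X) (β t) i) t) (i : Fin 3) :
    HasDerivAt (fun s => unstretchAt φ l s (flowAt φ l s X) (β s) i) 0 t := by
  have k1 := hasDerivAt_first_sin h l X t
  have k2 := hasDerivAt_first_cos h X t
  have k3 := hasDerivAt_second_sin h l X t
  have k4 := hasDerivAt_second_cos h l X t
  have b0 := hβ 0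
  have b1 := hβ 1
  have b2 := hβ 2
  rw [velocityGradient_zero] at b0
  rw [velocityGradient_one] at b1
  rw [velocityGradient_two] at b2
  have m0 := b0.sub (k3.mul b1)
  simp only [unstretchAt_flowAt]
  fin_cases i
  · refine m0.congr_deriv ?_
    rcases h.separation t with ⟨e1, e2, e3, e4⟩ | ⟨e1, e2⟩
    · simp only [e1, e3]
      push_cast
      ring
    · simp only [e1]
      push_cast
      ring
  · refine (b1.sub (k1.mul m0)).congr_deriv ?_
    rcases h.separation t with ⟨e1, e2, e3, e4⟩ | ⟨e1, e2⟩
    · rw [flowAt_apply_zero_of_rest l X t e1]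
      simp only [e1, e3, Pi.mul_apply, Pi.sub_apply]
      push_cast
      ring
    · simp only [e1, Pi.mul_apply, Pi.sub_apply]
      push_cast
      ring
  · refine ((b2.sub (k4.mul b1)).sub (k2.mul m0)).congr_deriv ?_
    rcases h.separation t with ⟨e1, e2, e3, e4⟩ | ⟨e1, e2⟩
    · rw [flowAt_apply_zero_of_rest l X t e1]
      simp only [e1, e2, e3, e4, Pi.mul_apply, Pi.sub_apply]
      push_cast
      ring
    · simp only [e1, e2, Pi.mul_apply, Pi.sub_apply]
      push_cast
      ring

end Derivatives

/-! ### Existence and uniqueness. -/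

/-- Cauchy's formula: a solution is transported and stretched by the flow. -/
lemma IsInductionSolution.eq_stretchAt (h : IsProfile φ) {l : ℝ} {b₀ : R3 → C3}
    {b : ℝ → R3 → C3} (hb : IsInductionSolution (flowW φ l) 0 0 2 b₀ b) {t : ℝ}
    (ht : t ∈ Set.Icc (0 : ℝ) 2) (x : R3) :
    b t x = stretchAt φ l t x (b₀ (invAt φ l t x)) := by
  set X := invAt φ l t x with hX
  have hx : flowAt φ l t X = x := shearMap_shearInv _ _ _ _ x
  have hflow : Continuous fun s => flowAt φ l s X :=
    continuous_iff_continuousAt.2 fun s => (hasDerivAt_flowAt h l X s).continuousAt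
  have hβc : ContinuousOn (fun s => b s (flowAt φ l s X)) (Set.Icc 0 t) :=
    hb.regular.continuousOn.comp (f := fun s => (s, flowAt φ l s X)) (by fun_prop)
      fun s hs => ⟨⟨hs.1, hs.2.trans ht.2⟩, trivial⟩
  have hβ : ∀ s ∈ Set.Ioo (0 : ℝ) t, ∀ i, HasDerivAt (fun s => b s (flowAt φ l s X) i)
      (velocityGradient (flowW φ l s) (flowAt φ l s X) (b s (flowAt φ l s X)) i) s := by
    intro s hs i
    have hs2 : s ∈ Set.Ioo (0 : ℝ) 2 := ⟨hs.1, hs.2.trans_le ht.2⟩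
    have hd : DifferentiableAt ℝ (fun p : ℝ × R3 => b p.1 p.2) (s, flowAt φ l s X) :=
      (hb.regular.differentiableOn (by norm_num)).differentiableAt
        (prod_mem_nhds (Icc_mem_nhds hs2.1 hs2.2) Filter.univ_mem)
    have hi : DifferentiableAt ℝ (fun p : ℝ × R3 => b p.1 p.2 i) (s, flowAt φ l s X) :=
      differentiableAt_pi.1 hd i
    refine (hasDerivAt_along (B := fun s y => b s y i) hi
      (hasDerivAt_flowAt h l X s)).congr_deriv ?_
    have := hb.equation s hs2 (flowAt φ l s X) i
    simp only [Complex.ofReal_zero, zero_mul, sub_zero] at this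
    exact sub_eq_zero.1 this
  have hcomp : ∀ i, unstretchAt φ l t x (b t x) i = b₀ X i := by
    intro i
    have hc : ContinuousOn (fun s => unstretchAt φ l s (flowAt φ l s X) (b s (flowAt φ l s X)) i)
        (Set.Icc 0 t) := by
      have c1 := continuous_iff_continuousAt.2 fun s => (hasDerivAt_first_sin h l X s).continuousAt
      have c2 := continuous_iff_continuousAt.2 fun s => (hasDerivAt_first_cos h X s).continuousAt
      have c3 := continuous_iff_continuousAt.2 fun s =>
        (hasDerivAt_second_sin h l X s).continuousAt
      have c4 := continuous_iff_continuousAt.2 fun s =>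
        (hasDerivAt_second_cos h l X s).continuousAt
      have d0 := continuousOn_pi.1 hβc 0
      have d1 := continuousOn_pi.1 hβc 1
      have d2 := continuousOn_pi.1 hβc 2
      have m0 := d0.sub (c3.continuousOn.mul d1)
      simp only [unstretchAt_flowAt]
      fin_cases i
      · exact m0
      · exact d1.sub (c1.continuousOn.mul m0)
      · exact (d2.sub (c4.continuousOn.mul d1)).sub (c2.continuousOn.mul m0)
    -- The unstretched field is conserved along the trajectory through `x`, so it equals the datum
    -- at the starting point `X`.
    have := eq_left_of_hasDerivAt_zero ht.1 hc fun s hs =>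
      hasDerivAt_unstretchAt h l X s (hβ s hs) i
    rwa [hx, flowAt_zero h, unstretchAt_zero h, hb.initial] at this
  rw [← funext hcomp]
  exact (stretch_unstretch _ _ _ _ x (b t x)).symm

lemma shearInv_add_int (a c a' c' : ℝ) (n : Fin 3 → ℤ) (x : R3) :
    shearInv a c a' c' (x + fun i => (n i : ℝ)) =
      shearInv a c a' c' x + fun i => (n i : ℝ) := by
  have e : x 0 + n 0 - a' * Real.cos (2 * Real.pi * x 1) =
    x 0 - a' * Real.cos (2 * Real.pi * x 1) + n 0 := by ring
  ext i
  fin_cases i <;>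
    simp [shearInv, cos_two_pi_add_int, sin_two_pi_add_int, e] <;> ring

lemma stretch_add_int (a c a' c' : ℝ) (n : Fin 3 → ℤ) (x : R3) (w : C3) :
    stretch a c a' c' (x + fun i => (n i : ℝ)) w = stretch a c a' c' x w := by
  simp only [stretch, shearInv_add_int, Pi.add_apply, cos_two_pi_add_int, sin_two_pi_add_int]

lemma contDiff_invAt (h : IsProfile φ) (l : ℝ) :
    ContDiff ℝ 2 fun p : ℝ × R3 => invAt φ l p.1 p.2 := by
  have hS : ContDiff ℝ 2 (primitive φ) := mod_cast contDiff_infty.1 h.contDiff_primitive 2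
  rw [contDiff_pi]
  intro i
  fin_cases i <;> simp only [invAt, shearInv, Fin.zero_eta, Fin.mk_one, Fin.reduceFinMk,
    Matrix.cons_val] <;> fun_prop

lemma contDiff_stretchAt (h : IsProfile φ) (l : ℝ) {w : ℝ × R3 → C3} (hw : ContDiff ℝ 2 w) :
    ContDiff ℝ 2 fun p : ℝ × R3 => stretchAt φ l p.1 p.2 (w p) := by
  have hS : ContDiff ℝ 2 (primitive φ) := mod_cast contDiff_infty.1 h.contDiff_primitive 2
  have hI := contDiff_pi.1 (contDiff_invAt h l) 0
  have hre : ∀ {f : ℝ × R3 → ℝ}, ContDiff ℝ 2 f → ContDiff ℝ 2 fun p => (f p : ℂ) :=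
    fun hf => Complex.ofRealCLM.contDiff.comp hf
  have k1 := hre (f := fun p => -(2 * Real.pi * (l * primitive φ p.1) *
    Real.sin (2 * Real.pi * invAt φ l p.1 p.2 0))) (by fun_prop)
  have k2 := hre (f := fun p => 2 * Real.pi * (1 / 4 * primitive φ (p.1 - 1 / 2)) *
    Real.cos (2 * Real.pi * invAt φ l p.1 p.2 0)) (by fun_prop)
  have k3 := hre (f := fun p => -(2 * Real.pi * (-l * primitive φ (p.1 - 1)) *
    Real.sin (2 * Real.pi * p.2 1))) (by fun_prop)
  have k4 := hre (f := fun p => 2 * Real.pi * (1 / 4 * primitive φ (p.1 - 1 - 1 / 2)) *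
    Real.cos (2 * Real.pi * p.2 1)) (by fun_prop)
  have w0 := contDiff_pi.1 hw 0
  have w1 := contDiff_pi.1 hw 1
  have w2 := contDiff_pi.1 hw 2
  have m1 := w1.add (k1.mul w0)
  rw [contDiff_pi]
  intro i
  fin_cases i
  · exact w0.add (k3.mul m1)
  · exact m1
  · exact (w2.add (k2.mul w0)).add (k4.mul m1)

lemma isInductionSolution_stretchAt (h : IsProfile φ) (l : ℝ) {b₀ : R3 → C3}
    (hb₀ : ContDiff ℝ 2 b₀) (hper : TorusPeriodic b₀) :
    IsInductionSolution (flowW φ l) 0 0 2 b₀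
      (fun t x => stretchAt φ l t x (b₀ (invAt φ l t x))) := by
  have hsm : ContDiff ℝ 2 fun p : ℝ × R3 =>
      stretchAt φ l p.1 p.2 (b₀ (invAt φ l p.1 p.2)) :=
    contDiff_stretchAt h l (hb₀.comp (contDiff_invAt h l))
  refine ⟨hsm.contDiffOn, fun τ _ n x => ?_, ?_, fun τ _ x i => ?_⟩
  · simp only [stretchAt, invAt, stretch_add_int, shearInv_add_int]
    rw [hper]
  · funext x
    rw [stretchAt_zero h, invAt_zero h]
  · set X := invAt φ l τ x with hX
    have hx : flowAt φ l τ X = x := shearMap_shearInv _ _ _ _ x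
    have hi : DifferentiableAt ℝ
        (fun p : ℝ × R3 => stretchAt φ l p.1 p.2 (b₀ (invAt φ l p.1 p.2)) i)
        (τ, flowAt φ l τ X) :=
      (contDiff_pi.1 hsm i).differentiable (by norm_num) _
    have h1 := hasDerivAt_along
      (B := fun s y => stretchAt φ l s y (b₀ (invAt φ l s y)) i) hi (hasDerivAt_flowAt h l X τ)
    have h2 := hasDerivAt_stretchAt h l X τ (b₀ X) i
    have h3 : ∀ s, invAt φ l s (flowAt φ l s X) = X := fun s => shearInv_shearMap _ _ _ _ X
    simp only [h3] at h1
    -- The same derivative along a trajectory is computed by the chain rule and from the explicit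
    -- differential; equating the two is the induction equation at `x`.
    have h4 := h1.unique h2
    simp only [hx] at h4
    simp only [Complex.ofReal_zero, zero_mul, sub_zero]
    exact sub_eq_zero.2 h4

lemma inductionWellPosed_flowW (h : IsProfile φ) (l : ℝ) {b₀ : R3 → C3}
    (hb₀ : ContDiff ℝ 2 b₀) (hper : TorusPeriodic b₀) :
    InductionWellPosed (flowW φ l) 0 0 2 b₀ :=
  ⟨_, isInductionSolution_stretchAt h l hb₀ hper, fun _ hb' _ hτ =>
    funext fun x => hb'.eq_stretchAt h hτ x⟩

lemma solutionOperator_flowW (h : IsProfile φ) (l : ℝ) {b₀ : R3 → C3}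
    (hb₀ : ContDiff ℝ 2 b₀) (hper : TorusPeriodic b₀) (x : R3) :
    solutionOperator (flowW φ l) 0 0 2 b₀ x =
      stretch l (1 / 4) (-l) (1 / 4) x (b₀ (shearInv l (1 / 4) (-l) (1 / 4) x)) := by
  have hex : ∃ b, IsInductionSolution (flowW φ l) 0 0 2 b₀ b :=
    ⟨_, isInductionSolution_stretchAt h l hb₀ hper⟩
  -- Cauchy's formula applies to whichever solution was chosen. At time `2` all four primitives
  -- equal `1`, the last one being evaluated exactly at `1/2`.
  rw [solutionOperator, dif_pos hex, hex.choose_spec.eq_stretchAt h ⟨zero_le_two, le_rfl⟩,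
    stretchAt, invAt, h.primitive_of_half_le (by norm_num), h.primitive_of_half_le (by norm_num),
    h.primitive_of_half_le (by norm_num), h.primitive_of_half_le (by norm_num)]
  simp only [mul_one]

/-! ### Plane waves and integration over the cube. -/

lemma character_add (k : Fin 3 → ℤ) (x : R3) (n : Fin 3 → ℤ) :
    character k (x + fun i => (n i : ℝ)) = character k x := by
  unfold character
  rw [Complex.exp_eq_exp_iff_exists_int]
  refine ⟨∑ i, k i * n i, ?_⟩
  simp only [Fin.sum_univ_three, Pi.add_apply]
  push_cast
  ring

lemma contDiff_planeWave (k : Fin 3 → ℤ) (v : C3) : ContDiff ℝ 2 (planeWave k v) := by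
  have hre : ∀ i, ContDiff ℝ 2 fun x : R3 => ((x i : ℝ) : ℂ) :=
    fun i => Complex.ofRealCLM.contDiff.comp (contDiff_apply ℝ ℝ i)
  unfold planeWave character
  fun_prop

lemma torusPeriodic_planeWave (k : Fin 3 → ℤ) (v : C3) : TorusPeriodic (planeWave k v) :=
  fun n x => by rw [planeWave, planeWave, character_add]

lemma integral_unit_of_periodic {H : ℝ → ℂ} (hp : Function.Periodic H 1) (s : ℝ) :
    ∫ x in Set.Icc (0 : ℝ) 1, H (x - s) = ∫ x in (0 : ℝ)..1, H x := by
  rw [integral_Icc_eq_integral_Ioc, ← intervalIntegral.integral_of_le zero_le_one,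
    intervalIntegral.integral_comp_sub_right]
  have := hp.intervalIntegral_add_eq (0 - s) 0
  rw [zero_add] at this
  rw [← this]
  congr 1
  ring

/-- For fixed `y`, integrating first in `x` over a full period removes the shift `s y`, leaving a
constant. The absent variable `z` contributes a factor one. -/
lemma integral_cube_mul_shift {G H : ℝ → ℂ} {s : ℝ → ℝ} (hG : Continuous G) (hH : Continuous H)
    (hs : Continuous s) (hp : Function.Periodic H 1) :
    ∫ x in Set.Icc (0 : R3) 1, G (x 1) * H (x 0 - s (x 1)) =
      (∫ y in (0 : ℝ)..1, G y) * ∫ x in (0 : ℝ)..1, H x := by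
  let μ : Measure ℝ := volume.restrict (Set.Icc 0 1)
  have : IsProbabilityMeasure μ := ⟨by simp [μ]⟩
  have hμ : (volume : Measure R3).restrict (Set.Icc 0 1) = Measure.pi fun _ => μ := by
    rw [← Measure.restrict_pi_pi, ← Set.pi_univ_Icc]
    rfl
  have hF : Continuous fun x : R3 => G (x 1) * H (x 0 - s (x 1)) := by fun_prop
  have hmp := measurePreserving_piFinSuccAbove (fun _ : Fin 3 => μ) 0
  set e := MeasurableEquiv.piFinSuccAbove (fun _ : Fin 3 => ℝ) 0
  let K : ℝ × (Fin 2 → ℝ) → ℂ := fun p => G (p.2 0) * H (p.1 - s (p.2 0))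
  have hint : Integrable K (μ.prod (Measure.pi fun _ : Fin 2 => μ)) := by
    rw [← hmp.integrable_comp_emb e.measurableEmbedding, ← hμ]
    exact hF.continuousOn.integrableOn_compact isCompact_Icc
  have h1 : ∫ x in Set.Icc (0 : R3) 1, G (x 1) * H (x 0 - s (x 1)) =
      ∫ p, K p ∂(μ.prod (Measure.pi fun _ : Fin 2 => μ)) := by
    rw [hμ]
    exact hmp.integral_comp e.measurableEmbedding K
  -- The symmetric form of Fubini puts the `x`-integral innermost.
  rw [h1, integral_prod_symm K hint]
  simp only [K, integral_const_mul]
  simp only [μ, integral_unit_of_periodic hp]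
  rw [integral_mul_const]
  congr 1
  have hev := measurePreserving_eval (fun _ : Fin 2 => μ) 0
  have h2 := integral_map hev.aemeasurable (f := G) hG.aestronglyMeasurable
  rw [hev.map_eq] at h2
  rw [intervalIntegral.integral_of_le zero_le_one, ← integral_Icc_eq_integral_Ioc]
  exact h2.symm

/-! ### Phase integrals and Bessel values. -/

/-- The phase factor gained by `e^{2πiz}` under a shear in the direction `e_z`. -/
noncomputable def phase (θ : ℝ) : ℂ :=
  Complex.exp (-(Real.pi / 2 * Real.sin (2 * Real.pi * θ) : ℝ) * Complex.I)

lemma continuous_phase : Continuous phase := by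
  unfold phase
  fun_prop

lemma phase_periodic : Function.Periodic phase 1 := by
  intro x
  have := sin_two_pi_add_int x 1
  rw [Int.cast_one] at this
  rw [phase, this, phase]

/-- `J₀(π/2)`. -/
noncomputable def besselZero : ℝ :=
  ∫ x in (0 : ℝ)..1, Real.cos (Real.pi / 2 * Real.sin (2 * Real.pi * x))

/-- `J₁(π/2)`. -/
noncomputable def besselOne : ℝ :=
  ∫ x in (0 : ℝ)..1, Real.sin (Real.pi / 2 * Real.sin (2 * Real.pi * x)) *
    Real.sin (2 * Real.pi * x)

/-- The amplitude `1/4` of the vertical shears makes the phase amplitude `π/2`, so the cosine never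
becomes negative; at `x = 0` it equals one. -/
lemma besselZero_pos : 0 < besselZero := by
  refine intervalIntegral.integral_pos zero_lt_one (by fun_prop) (fun x _ => ?_)
    ⟨0, by simp, by simp⟩
  have h1 := Real.sin_le_one (2 * Real.pi * x)
  have h2 := Real.neg_one_le_sin (2 * Real.pi * x)
  exact Real.cos_nonneg_of_neg_pi_div_two_le_of_le (by nlinarith [Real.pi_pos])
    (by nlinarith [Real.pi_pos])

/-- For phases in `[-π/2, π/2]` both factors of the integrand have the same sign, and at `x = 1/4`
both equal one. -/
lemma besselOne_pos : 0 < besselOne := by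
  refine intervalIntegral.integral_pos zero_lt_one (by fun_prop) (fun x _ => ?_)
    ⟨1 / 4, by norm_num, ?_⟩
  · have h1 := Real.sin_le_one (2 * Real.pi * x)
    have h2 := Real.neg_one_le_sin (2 * Real.pi * x)
    have hpi := Real.pi_pos
    rcases le_total 0 (Real.sin (2 * Real.pi * x)) with h | h
    · exact mul_nonneg (Real.sin_nonneg_of_nonneg_of_le_pi (by positivity) (by nlinarith)) h
    · exact mul_nonneg_of_nonpos_of_nonpos
        (Real.sin_nonpos_of_nonpos_of_neg_pi_le (by nlinarith) (by nlinarith)) h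
  · rw [show 2 * Real.pi * (1 / 4) = Real.pi / 2 by ring]
    simp

lemma integral_eq_zero_of_reflect {f : ℝ → ℝ} (hf : ∀ x, f (1 - x) = -f x) : ∫ x in (0 : ℝ)..1, f x = 0 := by
  have := intervalIntegral.integral_comp_sub_left (a := 0) (b := 1) f 1
  simp only [hf, intervalIntegral.integral_neg, sub_self, sub_zero] at this
  exact self_eq_neg.1 this.symm

lemma sin_two_pi_one_sub (x : ℝ) :
    Real.sin (2 * Real.pi * (1 - x)) = -Real.sin (2 * Real.pi * x) := by
  rw [mul_sub, mul_one, Real.sin_two_pi_sub]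

lemma phase_eq (x : ℝ) : phase x =
    ((Real.cos (Real.pi / 2 * Real.sin (2 * Real.pi * x)) : ℝ) : ℂ) -
      ((Real.sin (Real.pi / 2 * Real.sin (2 * Real.pi * x)) : ℝ) : ℂ) * Complex.I := by
  rw [phase, ← Complex.ofReal_neg, Complex.exp_mul_I, ← Complex.ofReal_cos, ← Complex.ofReal_sin,
    Real.cos_neg, Real.sin_neg]
  push_cast
  ring

lemma integral_phase : ∫ x in (0 : ℝ)..1, phase x = besselZero := by
  have h1 : ∫ x in (0 : ℝ)..1, Real.sin (Real.pi / 2 * Real.sin (2 * Real.pi * x)) = 0 :=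
    integral_eq_zero_of_reflect fun x => by rw [sin_two_pi_one_sub, mul_neg, Real.sin_neg]
  simp only [phase_eq]
  rw [intervalIntegral.integral_sub, intervalIntegral.integral_mul_const,
    intervalIntegral.integral_ofReal, intervalIntegral.integral_ofReal, h1, besselZero]
  · simp
  all_goals exact Continuous.intervalIntegrable (by fun_prop) _ _

lemma integral_phase_mul_sin :
    ∫ x in (0 : ℝ)..1, phase x * (Real.sin (2 * Real.pi * x) : ℂ) = -Complex.I * besselOne := by
  have h1 : ∫ x in (0 : ℝ)..1, Real.cos (Real.pi / 2 * Real.sin (2 * Real.pi * x)) *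
      Real.sin (2 * Real.pi * x) = 0 :=
    integral_eq_zero_of_reflect fun x => by
      rw [sin_two_pi_one_sub, mul_neg, mul_neg, Real.cos_neg]
  have h2 : ∀ x, phase x * (Real.sin (2 * Real.pi * x) : ℂ) =
      ((Real.cos (Real.pi / 2 * Real.sin (2 * Real.pi * x)) *
        Real.sin (2 * Real.pi * x) : ℝ) : ℂ) -
      ((Real.sin (Real.pi / 2 * Real.sin (2 * Real.pi * x)) *
        Real.sin (2 * Real.pi * x) : ℝ) : ℂ) * Complex.I := fun x => by
    rw [phase_eq, Complex.ofReal_mul, Complex.ofReal_mul]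
    ring
  simp only [h2]
  rw [intervalIntegral.integral_sub, intervalIntegral.integral_mul_const,
    intervalIntegral.integral_ofReal, intervalIntegral.integral_ofReal, h1, besselOne]
  · simp [mul_comm]
  all_goals exact Continuous.intervalIntegrable (by fun_prop) _ _

/-- The integrand is a constant multiple of the derivative of the periodic function `phase`. -/
lemma integral_phase_mul_cos :
    ∫ x in (0 : ℝ)..1, phase x * (Real.cos (2 * Real.pi * x) : ℂ) = 0 := by
  have hd : ∀ x ∈ Set.uIcc (0 : ℝ) 1, HasDerivAt phase
      (-(Real.pi ^ 2 : ℝ) * Complex.I * (phase x * (Real.cos (2 * Real.pi * x) : ℂ))) x := by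
    intro x _
    have h1 := ((((hasDerivAt_sin_two_pi x).const_mul (Real.pi / 2)).ofReal_comp.neg).mul_const
      Complex.I).cexp
    refine h1.congr_deriv ?_
    simp only [phase, Pi.neg_apply]
    push_cast
    ring
  have h := intervalIntegral.integral_eq_sub_of_hasDerivAt hd
    (Continuous.intervalIntegrable (by have := continuous_phase; fun_prop) _ _)
  rw [intervalIntegral.integral_const_mul] at h
  have hp : phase 1 - phase 0 = 0 := by simp [phase]
  rw [hp] at h
  refine (mul_eq_zero.1 h).resolve_left ?_
  simp [Real.pi_ne_zero]

/-- The phase factor times `1`, `sin 2πθ` and `cos 2πθ`. -/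
noncomputable def phaseTrig (j : Fin 3) (θ : ℝ) : ℂ :=
  phase θ * ((![1, Real.sin (2 * Real.pi * θ), Real.cos (2 * Real.pi * θ)] j : ℝ) : ℂ)

lemma continuous_phaseTrig (j : Fin 3) : Continuous (phaseTrig j) := by
  have := continuous_phase
  unfold phaseTrig
  fin_cases j <;> simp only [Fin.zero_eta, Fin.mk_one, Fin.reduceFinMk,
    Matrix.cons_val] <;> fun_prop

lemma phaseTrig_periodic (j : Fin 3) : Function.Periodic (phaseTrig j) 1 := by
  intro x
  have h1 := sin_two_pi_add_int x 1
  have h2 := cos_two_pi_add_int x 1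
  rw [Int.cast_one] at h1 h2
  rw [phaseTrig, h1, h2, phase_periodic, phaseTrig]

lemma integral_phaseTrig (j : Fin 3) :
    ∫ x in (0 : ℝ)..1, phaseTrig j x = ![(besselZero : ℂ), -Complex.I * besselOne, 0] j := by
  fin_cases j
  · simpa [phaseTrig] using integral_phase
  · exact integral_phase_mul_sin
  · exact integral_phase_mul_cos

/-! ### The Fourier matrix element. -/

lemma integral_cube_phaseTrig (M : Fin 3 → Fin 3 → ℂ) {s : ℝ → ℝ} (hs : Continuous s) :
    ∫ x in Set.Icc (0 : R3) 1,
        ∑ j, ∑ k, M j k * (phaseTrig j (x 1) * phaseTrig k (x 0 - s (x 1))) =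
      ∑ j, ∑ k, M j k * (![(besselZero : ℂ), -Complex.I * besselOne, 0] j *
        ![(besselZero : ℂ), -Complex.I * besselOne, 0] k) := by
  have hc : ∀ j k, Continuous fun x : R3 =>
      M j k * (phaseTrig j (x 1) * phaseTrig k (x 0 - s (x 1))) := fun j k => by
    have h1 := continuous_phaseTrig j
    have h2 := continuous_phaseTrig k
    fun_prop
  rw [integral_finsetSum _ fun j _ =>
    (continuous_finsetSum _ fun k _ => hc j k).continuousOn.integrableOn_compact isCompact_Icc]
  refine Finset.sum_congr rfl fun j _ => ?_
  rw [integral_finsetSum _ fun k _ =>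
    (hc j k).continuousOn.integrableOn_compact isCompact_Icc]
  refine Finset.sum_congr rfl fun k _ => ?_
  rw [integral_const_mul, integral_cube_mul_shift (continuous_phaseTrig j)
    (continuous_phaseTrig k) hs (phaseTrig_periodic k), integral_phaseTrig, integral_phaseTrig]

/-- The coordinate `z` cancels, leaving only the vertical displacements of the two shears, each with
phase amplitude `2π · 1/4 = π/2`. -/
lemma character_mul_shearInv (l : ℝ) (x : R3) :
    character (-eZ) x * character eZ (shearInv l (1 / 4) (-l) (1 / 4) x) =
      phase (x 1) * phase (x 0 - -l * Real.cos (2 * Real.pi * x 1)) := by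
  rw [character, character, phase, phase, ← Complex.exp_add, ← Complex.exp_add]
  congr 1
  simp only [eZ, shearInv, Fin.sum_univ_three, Pi.neg_apply, Matrix.cons_val]
  push_cast
  ring

/-- The matrix element `(e_z, e_z)` of the ideal dynamo `flowW φ l`, with `α = 2πl J₁(π/2)`. -/
noncomputable def dynamoMatrix (α : ℝ) : Matrix (Fin 3) (Fin 3) ℂ :=
  !![(besselZero : ℂ) ^ 2 + α ^ 2, -Complex.I * α * besselZero, 0;
    Complex.I * α * besselZero, (besselZero : ℂ) ^ 2, 0;
    0, 0, (besselZero : ℂ) ^ 2]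

/-- The coefficients of the product of the two shears in the basis `phaseTrig`. -/
noncomputable def shearCoefficient (l : ℝ) (v : C3) (i j k : Fin 3) : ℂ :=
  ![!![v 0, 0, 0; 2 * Real.pi * l * v 1, -(2 * Real.pi * l) ^ 2 * v 0, 0; 0, 0, 0],
    !![v 1, -(2 * Real.pi * l) * v 0, 0; 0, 0, 0; 0, 0, 0],
    !![v 2, 0, Real.pi / 2 * v 0; 0, 0, 0;
      Real.pi / 2 * v 1, -(Real.pi / 2) * (2 * Real.pi * l) * v 0, 0]] i j k

lemma character_smul_stretch (l : ℝ) (v : C3) (x : R3) (i : Fin 3) :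
    (character (-eZ) x • stretch l (1 / 4) (-l) (1 / 4) x
      (planeWave eZ v (shearInv l (1 / 4) (-l) (1 / 4) x))) i =
    ∑ j, ∑ k, shearCoefficient l v i j k *
      (phaseTrig j (x 1) * phaseTrig k (x 0 - -l * Real.cos (2 * Real.pi * x 1))) := by
  have hξ : shearInv l (1 / 4) (-l) (1 / 4) x 0 = x 0 - -l * Real.cos (2 * Real.pi * x 1) := rfl
  have hstr : ∀ c : ℂ, stretch l (1 / 4) (-l) (1 / 4) x (c • v) =
      c • stretch l (1 / 4) (-l) (1 / 4) x v := by
    intro c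
    ext i
    fin_cases i <;> simp [stretch] <;> ring
  rw [planeWave, hstr, smul_smul, character_mul_shearInv, Pi.smul_apply, smul_eq_mul]
  simp only [stretch, hξ, phaseTrig]
  generalize x 0 - -l * Real.cos (2 * Real.pi * x 1) = ξ
  fin_cases i <;>
  · simp only [shearCoefficient, Fin.sum_univ_three, Fin.zero_eta, Fin.mk_one, Fin.reduceFinMk,
      Matrix.cons_val, Matrix.of_apply]
    push_cast
    ring

lemma isFourierMatrixElement_flowW {φ : ℝ → ℝ} (h : IsProfile φ) (l : ℝ) :
    IsFourierMatrixElement (flowW φ l) 0 0 2 eZ eZ (dynamoMatrix (2 * Real.pi * l * besselOne)) := by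
  intro v
  have hc := contDiff_planeWave eZ v
  have hp := torusPeriodic_planeWave eZ v
  refine ⟨inductionWellPosed_flowW h l hc hp, ?_⟩
  have hs : Continuous fun y : ℝ => -l * Real.cos (2 * Real.pi * y) := by fun_prop
  ext i
  simp only [fourierCoefficient, solutionOperator_flowW h l hc hp]
  rw [eval_integral]
  · simp only [character_smul_stretch]
    rw [integral_cube_phaseTrig _ hs]
    fin_cases i <;>
      simp only [shearCoefficient, dynamoMatrix, Matrix.mulVec, dotProduct, Fin.sum_univ_three,
        Fin.zero_eta, Fin.mk_one, Fin.reduceFinMk, Matrix.cons_val, Matrix.of_apply] <;>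
      push_cast
    -- The product of the two sine integrals is `(-i J₁)² = -J₁²`; its sign cancels that of the
    -- coefficient and yields the growth term `+α²`.
    · linear_combination (2 * Real.pi * l * besselOne) ^ 2 * v 0 * Complex.I_sq
    · ring
    · ring
  · intro i
    simp only [character_smul_stretch]
    refine Continuous.integrableOn_Icc ?_
    refine continuous_finsetSum _ fun j _ => continuous_finsetSum _ fun k _ => ?_
    have h1 := continuous_phaseTrig j
    have h2 := continuous_phaseTrig k
    fun_prop

/-! ### Spectral analysis. -/

/-- Three distinct eigenvalues already exhaust the roots of a cubic characteristic polynomial, so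
none can repeat. -/
lemma IsEigenSystem.hasSimpleEigenvalues {A : Matrix (Fin 3) (Fin 3) ℂ} {μ : Fin 3 → ℂ}
    {ξ : Fin 3 → C3} (h : IsEigenSystem A μ ξ) : HasSimpleEigenvalues A := by
  have hroot : ∀ a, μ a ∈ A.charpoly.roots := by
    intro a
    rw [Polynomial.mem_roots A.charpoly_monic.ne_zero, ← Matrix.charpoly_toLin',
      ← Module.End.hasEigenvalue_iff_isRoot_charpoly]
    exact Module.End.hasEigenvalue_of_hasEigenvector
      (Module.End.hasEigenvector_iff.2 ⟨Module.End.mem_eigenspace_iff.2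
        (by rw [Matrix.toLin'_apply]; exact h.eigen a), h.ne_zero a⟩)
  let s : Finset ℂ := Finset.univ.map ⟨μ, h.distinct⟩
  have hle : s.val ≤ A.charpoly.roots := by
    rw [Multiset.le_iff_subset s.nodup]
    intro z hz
    obtain ⟨a, -, rfl⟩ := Finset.mem_map.1 (show z ∈ s from hz)
    exact hroot a
  have hcard : Multiset.card A.charpoly.roots ≤ Multiset.card s.val := by
    refine (Polynomial.card_roots' _).trans ?_
    rw [Matrix.charpoly_natDegree_eq_dim]
    simp [s]
  rw [HasSimpleEigenvalues, ← Multiset.eq_of_le_of_card_le hle hcard]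
  exact s.nodup

/-- The larger root `ν` of `ν² = α² ν + α² J₀(π/2)²`. -/
noncomputable def growthRoot (α : ℝ) : ℝ :=
  (α ^ 2 + Real.sqrt (α ^ 2 * (α ^ 2 + 4 * besselZero ^ 2))) / 2

lemma growthRoot_sq (α : ℝ) :
    growthRoot α ^ 2 = α ^ 2 * growthRoot α + α ^ 2 * besselZero ^ 2 := by
  have := Real.sq_sqrt (show 0 ≤ α ^ 2 * (α ^ 2 + 4 * besselZero ^ 2) by positivity)
  unfold growthRoot
  linear_combination this / 4

lemma growthRoot_neg (α : ℝ) : growthRoot (-α) = growthRoot α := by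
  simp [growthRoot]

lemma lt_growthRoot {α : ℝ} (hα : α ≠ 0) : α ^ 2 < growthRoot α := by
  have h1 : α ^ 2 < Real.sqrt (α ^ 2 * (α ^ 2 + 4 * besselZero ^ 2)) := by
    apply Real.lt_sqrt_of_sq_lt
    have := besselZero_pos
    have : 0 < α ^ 2 * besselZero ^ 2 := by positivity
    nlinarith
  unfold growthRoot
  linarith

/-- After subtracting `J₀²`, the upper block has trace `α²` and determinant `-α²J₀²`, so its
eigenvalues are `ν` and `α² - ν`. -/
noncomputable def dynamoEigenvalue (α : ℝ) : Fin 3 → ℂ :=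
  ![((besselZero ^ 2 + growthRoot α : ℝ) : ℂ),
    ((besselZero ^ 2 + (α ^ 2 - growthRoot α) : ℝ) : ℂ), ((besselZero ^ 2 : ℝ) : ℂ)]

noncomputable def dynamoEigenvector (α : ℝ) : Fin 3 → C3 :=
  ![![Complex.I * α * besselZero, ((α ^ 2 - growthRoot α : ℝ) : ℂ), 0],
    ![Complex.I * α * besselZero, (growthRoot α : ℂ), 0], ![0, 0, 1]]

lemma isEigenSystem_dynamoMatrix {α : ℝ} (hα : α ≠ 0) :
    IsEigenSystem (dynamoMatrix α) (dynamoEigenvalue α) (dynamoEigenvector α) := by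
  have hν := lt_growthRoot hα
  have hα2 : 0 < α ^ 2 := by positivity
  have hj := besselZero_pos
  have hj2 : 0 < besselZero ^ 2 := by positivity
  have hsq : (growthRoot α : ℂ) ^ 2 = α ^ 2 * growthRoot α + α ^ 2 * besselZero ^ 2 := by
    exact_mod_cast growthRoot_sq α
  have h3 : besselZero ^ 2 + (α ^ 2 - growthRoot α) < besselZero ^ 2 := by linarith
  have h4 : besselZero ^ 2 < besselZero ^ 2 + growthRoot α := by linarith
  refine ⟨?_, ?_, ?_, ?_⟩
  · intro a b hab
    fin_cases a <;> fin_cases b <;>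
      simp only [dynamoEigenvalue, Fin.zero_eta, Fin.mk_one, Fin.reduceFinMk, Matrix.cons_val,
        Complex.ofReal_inj] at hab ⊢ <;> linarith
  · intro a ha
    have hI : Complex.I * α * besselZero ≠ 0 := by
      simp [hα, hj.ne']
    fin_cases a
    · exact hI (congrFun ha 0)
    · exact hI (congrFun ha 0)
    · exact one_ne_zero (congrFun ha 2)
  · intro a
    ext i
    fin_cases a <;> fin_cases i <;>
      simp [dynamoEigenvalue, dynamoEigenvector, dynamoMatrix, Matrix.mulVec, dotProduct,
        Fin.sum_univ_three]
    -- The first row holds identically; the second row is where the quadratic equation for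
    -- `growthRoot` enters.
    · ring
    · linear_combination (α : ℂ) ^ 2 * besselZero ^ 2 * Complex.I_sq + hsq
    · ring
    · linear_combination (α : ℂ) ^ 2 * besselZero ^ 2 * Complex.I_sq + hsq
  · intro a ha
    fin_cases a
    · exact absurd rfl ha
    · simp only [dynamoEigenvalue, Fin.mk_one, Matrix.cons_val, Complex.norm_real, Real.norm_eq_abs]
      rw [abs_of_pos (by linarith : 0 < besselZero ^ 2 + growthRoot α), abs_lt]
      constructor <;> linarith
    · simp only [dynamoEigenvalue, Fin.reduceFinMk, Matrix.cons_val, Complex.norm_real,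
        Real.norm_eq_abs]
      rw [abs_of_pos (by linarith : 0 < besselZero ^ 2 + growthRoot α), abs_of_pos hj2]
      exact h4

lemma lt_norm_dynamoEigenvalue {α : ℝ} (hα : α ≠ 0) : α ^ 2 < ‖dynamoEigenvalue α 0‖ := by
  have hν := lt_growthRoot hα
  have := sq_nonneg besselZero
  simp only [dynamoEigenvalue, Matrix.cons_val, Complex.norm_real, Real.norm_eq_abs]
  exact lt_of_lt_of_le (by linarith) (le_abs_self _)

/-- The spans of the subdominant eigenvectors for `α` and `-α` meet in multiples of `e_z`. -/
lemma eq_zero_of_mem_span_dynamoEigenvector {α : ℝ} (hα : α ≠ 0) {v : C3} (hv : v 2 = 0)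
    (h1 : v ∈ Submodule.span ℂ {dynamoEigenvector α 1, dynamoEigenvector α 2})
    (h2 : v ∈ Submodule.span ℂ {dynamoEigenvector (-α) 1, dynamoEigenvector (-α) 2}) :
    v = 0 := by
  obtain ⟨c, d, rfl⟩ := Submodule.mem_span_pair.1 h1
  obtain ⟨c', d', h⟩ := Submodule.mem_span_pair.1 h2
  have hν : (growthRoot α : ℂ) ≠ 0 := by
    exact_mod_cast ((sq_nonneg α).trans_lt (lt_growthRoot hα)).ne'
  have hp : Complex.I * α * besselZero ≠ 0 := by
    simp [hα, besselZero_pos.ne']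
  have e0 := congrFun h 0
  have e1 := congrFun h 1
  simp only [dynamoEigenvector, growthRoot_neg, Matrix.cons_val, Pi.add_apply, Pi.smul_apply,
    smul_eq_mul, Complex.ofReal_neg, mul_zero, add_zero, zero_add, mul_one] at e0 e1 hv
  -- The `y`-coordinates agree for `α` and `-α`, which forces equal coefficients; the
  -- `x`-coordinates are opposite, which then forces them to vanish.
  have ec : c' = c := mul_right_cancel₀ hν e1
  have e2 : c * (Complex.I * α * besselZero) = 0 := by
    rw [ec] at e0
    linear_combination -(1 / 2) * e0
  have hc : c = 0 := (mul_eq_zero.1 e2).resolve_right hp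
  rw [hc, hv]
  simp

end KinematicDynamo

theorem mainTheorem6 :
    ∃ u₁ u₂ : ℝ → R3 → R3,
      (∃ (φ : ℝ → ℝ) (R : ℝ), IsProfile φ ∧ 0 < R ∧ u₁ = flowW φ R ∧ u₂ = flowW φ (-R)) ∧
      IsSmoothCompactField 0 2 u₁ ∧ IsSmoothCompactField 0 2 u₂ ∧
      DivergenceFree u₁ ∧ DivergenceFree u₂ ∧
      ∃ A₁ A₂ : Matrix (Fin 3) (Fin 3) ℂ,
        IsFourierMatrixElement u₁ 0 0 2 eZ eZ A₁ ∧
        IsFourierMatrixElement u₂ 0 0 2 eZ eZ A₂ ∧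
        HasSimpleEigenvalues A₁ ∧ HasSimpleEigenvalues A₂ ∧
        ∃ (μ₁ μ₂ : Fin 3 → ℂ) (ξ₁ ξ₂ : Fin 3 → C3),
          IsEigenSystem A₁ μ₁ ξ₁ ∧ IsEigenSystem A₂ μ₂ ξ₂ ∧
          Real.exp 1 < ‖μ₁ 0‖ ∧ Real.exp 1 < ‖μ₂ 0‖ ∧
          ∀ v : C3, v ≠ 0 → ∑ i, (eZ i : ℂ) * v i = 0 →
            v ∉ Submodule.span ℂ {ξ₁ 1, ξ₁ 2} ∨ v ∉ Submodule.span ℂ {ξ₂ 1, ξ₂ 2} := by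
  obtain ⟨φ, hφ⟩ := exists_isProfile
  have hJ := besselOne_pos
  -- This normalizes `α` to `±2π`; any amplitude with `α² ≥ e` would serve.
  set R : ℝ := 1 / besselOne with hR
  have hα₁ : 2 * Real.pi * R * besselOne = 2 * Real.pi := by
    rw [hR]
    field_simp
  have hα₂ : 2 * Real.pi * -R * besselOne = -(2 * Real.pi) := by
    linear_combination -hα₁
  have hF₁ := isFourierMatrixElement_flowW hφ R
  have hF₂ := isFourierMatrixElement_flowW hφ (-R)
  rw [hα₁] at hF₁
  rw [hα₂] at hF₂
  have h1 : (2 * Real.pi : ℝ) ≠ 0 := Real.two_pi_pos.ne'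
  have h2 : -(2 * Real.pi : ℝ) ≠ 0 := neg_ne_zero.2 h1
  have hE₁ := isEigenSystem_dynamoMatrix h1
  have hE₂ := isEigenSystem_dynamoMatrix h2
  have he : Real.exp 1 < (2 * Real.pi) ^ 2 := by
    nlinarith [Real.exp_one_lt_d9, Real.pi_gt_three]
  refine ⟨flowW φ R, flowW φ (-R), ⟨φ, R, hφ, one_div_pos.2 hJ, rfl, rfl⟩,
    isSmoothCompactField_flowW hφ R, isSmoothCompactField_flowW hφ (-R),
    divergenceFree_flowW φ R, divergenceFree_flowW φ (-R), _, _, hF₁, hF₂,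
    hE₁.hasSimpleEigenvalues, hE₂.hasSimpleEigenvalues, _, _, _, _, hE₁, hE₂,
    he.trans (lt_norm_dynamoEigenvalue h1),
    he.trans (neg_sq (2 * Real.pi) ▸ lt_norm_dynamoEigenvalue h2), fun v hv hz => ?_⟩
  have hv2 : v 2 = 0 := by simpa [Fin.sum_univ_three, eZ] using hz
  by_contra! hcon
  exact hv (eq_zero_of_mem_span_dynamoEigenvector h1 hv2 hcon.1 hcon.2)
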